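/- Let $p:\mathbb R\to\mathbb R$ be measurable with $\inf_{x\in\mathbb R}p(x)>0$, and let $A_p f=-(pf')'$ be the maximal operator in (complex) $L^2(\mathbb R)$ with domain $\{f\in L^2(\mathbb R): f,\,pf'\in AC_{loc}(\mathbb R),\ (pf')'\in L^2(\mathbb R)\}$; this operator is self-adjoint. Let $\Omega>0$, let $\Lambda\subseteq[0,\Omega]$ be a Borel set, let $P_\Lambda=c_\Lambda(A_p)$ be the spectral projection of $A_p$ for $\Lambda$, and let $PW_\Lambda(A_p)=\{f\in L^2(\mathbb R): f=P_\Lambda f\}$; its elements have continuous representatives, by means of which point values are understood. Let $(x_i)_{i\in\mathbb Z}$ be an increasing sequence of real numbers with $\lim_{i\to\pm\infty}x_i=\pm\infty$, put $y_i=\tfrac12(x_i+x_{i+1})$, let $\chi_i$ be the characteristic function of $[y_{i-1},y_i)$, and assume the maximal gap condition $$\delta=\sup_{i\in\mathbb Z}\frac{x_{i+1}-x_i}{\inf_{x\in[x_i,x_{i+1}]}\sqrt{p(x)}}<\frac{\pi}{\Omega^{1/2}} .$$ Then every $f\in PW_\Lambda(A_p)$ is reconstructed from its samples $(f(x_i))_{i\in\mathbb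 Z}$ by the following algorithm. Set $$f_0=h_0=P_\Lambda\Big(\sum_{i\in\mathbb Z}f(x_i)\chi_i\Big),\qquad h_{n+1}=h_n-P_\Lambda\Big(\sum_{i\in\mathbb Z}h_n(x_i)\chi_i\Big),\qquad f_{n+1}=f_n+h_{n+1}\qquad(n\ge 0).$$ All the sums $\sum_i f(x_i)\chi_i$ and $\sum_i h_n(x_i)\chi_i$ belong to $L^2(\mathbb R)$, all $h_n$ belong to $PW_\Lambda(A_p)$, and $$f=\lim_{n\to\infty}f_n=\sum_{n=0}^\infty h_n\quad\text{in }L^2(\mathbb R),$$ with the error estimate, for all $n\ge 0$, $$\|f-f_n\|\le\Big(\frac{\delta\,\Omega^{1/2}}{\pi}\Big)^{n+1}\,\frac{\pi+\delta\,\Omega^{1/2}}{\pi-\delta\,\Omega^{1/2}}\,\|f\| .$$ -/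

import Mathlib

open MeasureTheory Filter Topology

namespace VarBandwidth

noncomputable section

/-! ### Projection-valued measures and spectral projections -/

/-- A projection-valued measure on the Borel sets of `ℝ` with values in the orthogonal projections
of the Hilbert space `H`; it is countably additive in the strong operator topology. -/
structure ProjectionValuedMeasure (H : Type*) [NormedAddCommGroup H] [InnerProductSpace ℂ H]
    [CompleteSpace H] where
  /-- The projection attached to a Borel set (the values on other sets are irrelevant). -/
  proj : Set ℝ → (H →L[ℂ] H)
  isStarProjection : ∀ S, MeasurableSet S → IsStarProjection (proj S)
  empty : proj ∅ = 0
  univ : proj Set.univ = 1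
  inter : ∀ S T, MeasurableSet S → MeasurableSet T → proj (S ∩ T) = proj S * proj T
  iUnion : ∀ S : ℕ → Set ℝ, (∀ n, MeasurableSet (S n)) → Pairwise (Function.onFun Disjoint S) →
    ∀ f : H, HasSum (fun n => proj (S n) f) (proj (⋃ n, S n) f)

namespace ProjectionValuedMeasure

variable {H : Type*} [NormedAddCommGroup H] [InnerProductSpace ℂ H] [CompleteSpace H]

theorem re_inner_proj_nonneg (E : ProjectionValuedMeasure H) (f : H) (S : Set ℝ)
    (hS : MeasurableSet S) : 0 ≤ (inner ℂ f (E.proj S f)).re := by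
  have h := E.isStarProjection S hS
  have hidem : E.proj S (E.proj S f) = E.proj S f :=
    congrArg (fun T : H →L[ℂ] H => T f) h.isIdempotentElem
  have hadj : ContinuousLinearMap.adjoint (E.proj S) = E.proj S := h.isSelfAdjoint
  have key : inner ℂ f (E.proj S f) = inner ℂ (E.proj S f) (E.proj S f) := by
    rw [← ContinuousLinearMap.adjoint_inner_right, hadj, hidem]
  rw [key]
  exact inner_self_nonneg (𝕜 := ℂ)

/-- The scalar spectral measure `μ_f(S) = ⟨f, E(S) f⟩` of a vector `f`. -/
def scalarMeasure (E : ProjectionValuedMeasure H) (f : H) : Measure ℝ :=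
  Measure.ofMeasurable (fun S _ => ENNReal.ofReal (inner ℂ f (E.proj S f)).re)
    (by simp [E.empty])
    (by
      intro S hS hd
      have h1 := (E.iUnion S hS hd f).mapL (innerSL ℂ f)
      have h2 := Complex.hasSum_re h1
      simp only [innerSL_apply_apply] at h2
      rw [← h2.tsum_eq]
      exact ENNReal.ofReal_tsum_of_nonneg
        (fun n => E.re_inner_proj_nonneg f (S n) (hS n)) h2.summable)

/-- `E` is the spectral measure (resolution of the identity) of the unbounded operator `A`, that is
`A = ∫ λ dE(λ)`: the domain of `A` consists of the `f` with `∫ λ² dμ_f(λ) < ∞`, and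
`⟨f, A f⟩ = ∫ λ dμ_f(λ)` there. -/
structure IsSpectralMeasureOf (E : ProjectionValuedMeasure H) (A : H →ₗ.[ℂ] H) : Prop where
  mem_domain_iff : ∀ f : H,
    f ∈ A.domain ↔ ∫⁻ l, ENNReal.ofReal (l ^ 2) ∂(E.scalarMeasure f) < ⊤
  inner_apply : ∀ f : A.domain,
    inner ℂ (f : H) (A f) = ((∫ l, l ∂(E.scalarMeasure (f : H)) : ℝ) : ℂ)

end ProjectionValuedMeasure

open Classical in
/-- The spectral projection `c_S(A)` of an operator `A` for the Borel set `S`: the value `E(S)` of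
the spectral measure `E` of `A`. By the spectral theorem a self-adjoint `A` has exactly one
spectral measure; an operator without a spectral measure gets the junk value `0`. -/
def spectralProjection {H : Type*} [NormedAddCommGroup H] [InnerProductSpace ℂ H]
    [CompleteSpace H] (A : H →ₗ.[ℂ] H) (S : Set ℝ) : H →L[ℂ] H :=
  if h : ∃ E : ProjectionValuedMeasure H, E.IsSpectralMeasureOf A then h.choose.proj S else 0

/-! ### The Sturm-Liouville operator `A_p f = -(p f')'` -/

/-- Complex-valued `L²(ℝ)`. -/
abbrev L2R : Type := Lp ℂ 2 (volume : Measure ℝ)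

/-- Locally absolutely continuous functions on `ℝ`. -/
def ACLoc (F : ℝ → ℂ) : Prop := ∀ a b : ℝ, AbsolutelyContinuousOnInterval F a b

theorem ACLoc.continuous {F : ℝ → ℂ} (h : ACLoc F) : Continuous F := by
  rw [continuous_iff_continuousAt]
  intro t
  have hlt : t - 1 < t + 1 := by linarith
  have h1 := (h (t - 1) (t + 1)).continuousOn
  rw [Set.uIcc_of_le hlt.le] at h1
  exact h1.continuousAt (Icc_mem_nhds (by linarith) (by linarith))

theorem ACLoc.ae_differentiableAt {F : ℝ → ℂ} (h : ACLoc F) :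
    ∀ᵐ t : ℝ, DifferentiableAt ℝ F t := by
  have h1 : ∀ n : ℕ, ∀ᵐ t : ℝ, t ∈ Set.uIcc (-(n : ℝ)) n → DifferentiableAt ℝ F t := fun n =>
    (h (-(n : ℝ)) n).boundedVariationOn.ae_differentiableAt_of_mem_uIcc
  filter_upwards [ae_all_iff.2 h1] with t ht
  obtain ⟨n, hn⟩ := exists_nat_ge |t|
  refine ht n ?_
  rw [Set.uIcc_of_le (by linarith [abs_nonneg t])]
  exact abs_le.1 hn

/-- `SLRel p f g` says that `f` lies in the domain of the maximal operator `A_p` and that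
`g = A_p f = -(p f')'`: the class `f` has a locally absolutely continuous representative `F`, the
function `p F'` agrees almost everywhere with a locally absolutely continuous function `G`, and
`g ∈ L²(ℝ)` is `-G'`. -/
def SLRel (p : ℝ → ℝ) (f g : L2R) : Prop :=
  ∃ F G : ℝ → ℂ, ACLoc F ∧ ACLoc G ∧ f =ᵐ[volume] F ∧
    (G =ᵐ[volume] fun t => (p t : ℂ) * deriv F t) ∧ g =ᵐ[volume] fun t => -deriv G t

/-- The graph of the maximal operator `A_p`. -/
def slGraph (p : ℝ → ℝ) : Submodule ℂ (L2R × L2R) where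
  carrier := {z | SLRel p z.1 z.2}
  zero_mem' := by
    have h0 : ACLoc (fun _ => (0 : ℂ)) := fun a b => by
      simpa [AbsolutelyContinuousOnInterval] using tendsto_const_nhds
    refine ⟨fun _ => 0, fun _ => 0, h0, h0, ?_, ?_, ?_⟩
    · exact Lp.coeFn_zero ℂ 2 volume
    · simp
    · filter_upwards [Lp.coeFn_zero ℂ 2 (volume : Measure ℝ)] with t ht
      simp
  add_mem' := by
    rintro ⟨f₁, g₁⟩ ⟨f₂, g₂⟩ ⟨F₁, G₁, hF₁, hG₁, hf₁, hp₁, hg₁⟩ ⟨F₂, G₂, hF₂, hG₂, hf₂, hp₂, hg₂⟩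
    refine ⟨F₁ + F₂, G₁ + G₂, fun a b => (hF₁ a b).add (hF₂ a b),
      fun a b => (hG₁ a b).add (hG₂ a b), ?_, ?_, ?_⟩
    · exact (Lp.coeFn_add f₁ f₂).trans (hf₁.add hf₂)
    · filter_upwards [hp₁, hp₂, hF₁.ae_differentiableAt, hF₂.ae_differentiableAt]
        with t h1 h2 d1 d2
      rw [deriv_add d1 d2, Pi.add_apply, h1, h2, mul_add]
    · filter_upwards [Lp.coeFn_add g₁ g₂, hg₁, hg₂, hG₁.ae_differentiableAt,
        hG₂.ae_differentiableAt] with t h0 h1 h2 d1 d2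
      change (↑↑(g₁ + g₂) : ℝ → ℂ) t = _
      rw [deriv_add d1 d2, h0, Pi.add_apply, h1, h2, neg_add]
  smul_mem' := by
    rintro c ⟨f, g⟩ ⟨F, G, hF, hG, hf, hp, hg⟩
    refine ⟨fun t => c • F t, fun t => c • G t, fun a b => (hF a b).const_smul c,
      fun a b => (hG a b).const_smul c, ?_, ?_, ?_⟩
    · exact (Lp.coeFn_smul c f).trans (hf.const_smul c)
    · filter_upwards [hp, hF.ae_differentiableAt] with t h1 d1
      rw [deriv_fun_const_smul c d1, h1, smul_eq_mul, smul_eq_mul]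
      ring
    · filter_upwards [Lp.coeFn_smul c g, hg, hG.ae_differentiableAt] with t h0 h1 d1
      change (↑↑(c • g) : ℝ → ℂ) t = _
      rw [deriv_fun_const_smul c d1, h0, Pi.smul_apply, h1, smul_neg]

/-- The relation defining `A_p` is single-valued. -/
theorem slGraph_functional (p : ℝ → ℝ) (z : L2R × L2R) (hz : z ∈ slGraph p) (h0 : z.1 = 0) :
    z.2 = 0 := by
  obtain ⟨F, G, hF, hG, hf, hp, hg⟩ := hz
  have hF0 : F = fun _ => 0 := by
    refine (hF.continuous.ae_eq_iff_eq (μ := (volume : Measure ℝ)) continuous_const).1 ?_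
    rw [h0] at hf
    exact hf.symm.trans (Lp.coeFn_zero ℂ 2 volume)
  have hG0 : G = fun _ => 0 := by
    refine (hG.continuous.ae_eq_iff_eq (μ := (volume : Measure ℝ)) continuous_const).1 ?_
    filter_upwards [hp] with t ht
    simpa [hF0] using ht
  refine Lp.ext ?_
  filter_upwards [hg, Lp.coeFn_zero ℂ 2 (volume : Measure ℝ)] with t h1 h2
  rw [h1, h2, hG0]
  simp

/-- The maximal operator `A_p f = -(p f')'` in `L²(ℝ)`, with domain
`{f ∈ L²(ℝ) : f, p f' ∈ AC_loc, (p f')' ∈ L²(ℝ)}`. -/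
def slOperator (p : ℝ → ℝ) : L2R →ₗ.[ℂ] L2R := (slGraph p).toLinearPMap

theorem mem_graph_slOperator (p : ℝ → ℝ) (f g : L2R) :
    (f, g) ∈ (slOperator p).graph ↔ SLRel p f g := by
  rw [slOperator, Submodule.toLinearPMap_graph_eq _ (slGraph_functional p)]
  exact Iff.rfl

/-- `P_Λ = c_Λ(A_p)`. -/
def pwProj (p : ℝ → ℝ) (L : Set ℝ) : L2R →L[ℂ] L2R := spectralProjection (slOperator p) L

/-- The Paley-Wiener space `PW_Λ(A_p)`, i.e. all `f ∈ L²(ℝ)` with `f = c_Λ(A_p) f`. -/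
def PW (p : ℝ → ℝ) (L : Set ℝ) : Set L2R := {f | f = pwProj p L f}

/-! ### Sampling -/

/-- The class `f` has a continuous representative. -/
def HasContRep (f : L2R) : Prop := ∃ F : ℝ → ℂ, Continuous F ∧ f =ᵐ[volume] F

open Classical in
/-- The point value `f(t)`, read off the (unique) continuous representative of `f`. -/
def pointValue (f : L2R) (t : ℝ) : ℂ := if h : HasContRep f then h.choose t else f t

/-- The sequence of samples `(f(x_i))_{i ∈ ℤ}`. -/
def samples (x : ℤ → ℝ) (f : L2R) : ℤ → ℂ := fun i => pointValue f (x i)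

/-- The midpoints `y_i = (x_i + x_{i+1}) / 2`. -/
def midpt (x : ℤ → ℝ) (i : ℤ) : ℝ := (x i + x (i + 1)) / 2

/-- The characteristic function `χ_i` of `[y_{i-1}, y_i)`. -/
def chi (x : ℤ → ℝ) (i : ℤ) : ℝ → ℂ :=
  Set.indicator (Set.Ico (midpt x (i - 1)) (midpt x i)) 1

/-- The step function `∑_i c_i χ_i` (at each point at most one term is nonzero). -/
def stepFun (x : ℤ → ℝ) (c : ℤ → ℂ) : ℝ → ℂ := fun t => ∑' i : ℤ, c i * chi x i t

open Classical in
/-- `∑_i c_i χ_i` as an element of `L²(ℝ)` (junk value `0` if it is not square-integrable). -/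
def stepL2 (x : ℤ → ℝ) (c : ℤ → ℂ) : L2R :=
  if h : MemLp (stepFun x c) 2 (volume : Measure ℝ) then h.toLp (stepFun x c) else 0

/-- The weighted gap `(x_{i+1} - x_i) / inf_{[x_i, x_{i+1}]} √p`. -/
def weightedGap (p : ℝ → ℝ) (x : ℤ → ℝ) (i : ℤ) : ℝ :=
  (x (i + 1) - x i) / ⨅ t : Set.Icc (x i) (x (i + 1)), √(p t)

/-- The increments `h_n` of the reconstruction algorithm, computed from the sampled values `c`:
`h_0 = P_Λ(∑ c_i χ_i)` and `h_{n+1} = h_n - P_Λ(∑ h_n(x_i) χ_i)`. -/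
def increment (p : ℝ → ℝ) (L : Set ℝ) (x : ℤ → ℝ) (c : ℤ → ℂ) : ℕ → L2R
  | 0 => pwProj p L (stepL2 x c)
  | n + 1 => increment p L x c n - pwProj p L (stepL2 x (samples x (increment p L x c n)))

/-- The approximations `f_0 = h_0`, `f_{n+1} = f_n + h_{n+1}`. -/
def approx (p : ℝ → ℝ) (L : Set ℝ) (x : ℤ → ℝ) (c : ℤ → ℂ) : ℕ → L2R
  | 0 => increment p L x c 0
  | n + 1 => approx p L x c n + increment p L x c (n + 1)

end

end VarBandwidth

/-!
On each half of a cell `[y_{i-1}, y_i)` the function `g - g(x_i)` vanishes at the endpoint `x_i`, so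
Wirtinger's inequality and the gap condition bound the sampling error `‖g - ∑ g(x_i) χ_i‖` by
`δ / π` times the square root of the energy `∫ p |g'|²`. Integration by parts bounds the energy by
`Re ⟨g, A_p g⟩`, and the spectral theorem bounds this by `Ω ‖g‖²` on the Paley-Wiener space. Hence
`g ↦ g - P_Λ (∑ g(x_i) χ_i)` contracts `PW_Λ(A_p)` by the factor `γ = δ √Ω / π < 1`. The increments
`h_n` are the differences of consecutive iterates of this contraction at `f`, so the series
telescopes and `f - f_n` is its `(n + 1)`-st iterate.
-/

namespace VarBandwidth

open Set Real
open scoped ENNReal RealInnerProductSpace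

section AbsolutelyContinuous

variable {E : Type*} [NormedAddCommGroup E] {F G : ℝ → E} {a b : ℝ}

theorem absolutelyContinuousOnInterval_norm (hF : AbsolutelyContinuousOnInterval F a b) :
    AbsolutelyContinuousOnInterval (fun t => ‖F t‖) a b := by
  unfold AbsolutelyContinuousOnInterval at hF ⊢
  exact squeeze_zero (fun _ => Finset.sum_nonneg fun _ _ => dist_nonneg)
    (fun _ => Finset.sum_le_sum fun _ _ => (dist_norm_norm_le _ _).trans_eq (dist_eq_norm _ _).symm)
    hF

theorem absolutelyContinuousOnInterval_sub_const (hF : AbsolutelyContinuousOnInterval F a b)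
    (c : E) : AbsolutelyContinuousOnInterval (fun t => F t - c) a b := by
  unfold AbsolutelyContinuousOnInterval at hF ⊢
  simpa only [dist_sub_right] using hF

theorem continuous_of_forall_absolutelyContinuousOnInterval
    (hF : ∀ a b, AbsolutelyContinuousOnInterval F a b) : Continuous F :=
  continuous_iff_continuousAt.2 fun t =>
    (hF (t - 1) (t + 1)).continuousOn.continuousAt <| by
      rw [uIcc_of_le (by linarith)]
      exact Icc_mem_nhds (by linarith) (by linarith)

variable [InnerProductSpace ℝ E]

theorem absolutelyContinuousOnInterval_inner (hF : AbsolutelyContinuousOnInterval F a b)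
    (hG : AbsolutelyContinuousOnInterval G a b) :
    AbsolutelyContinuousOnInterval (fun t => ⟪F t, G t⟫) a b := by
  have norm_mul_self {K : ℝ → E} (hK : AbsolutelyContinuousOnInterval K a b) :
      AbsolutelyContinuousOnInterval (fun t => ‖K t‖ * ‖K t‖) a b :=
    (absolutelyContinuousOnInterval_norm hK).fun_mul (absolutelyContinuousOnInterval_norm hK)
  have polarization : (fun t => ⟪F t, G t⟫) = fun t =>
      2⁻¹ * (‖F t + G t‖ * ‖F t + G t‖ - ‖F t‖ * ‖F t‖ - ‖G t‖ * ‖G t‖) := by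
    funext t
    rw [real_inner_eq_norm_add_mul_self_sub_norm_mul_self_sub_norm_mul_self_div_two]
    ring
  rw [polarization]
  exact (((norm_mul_self (hF.fun_add hG)).fun_sub (norm_mul_self hF)).fun_sub
    (norm_mul_self hG)).const_mul _

variable [FiniteDimensional ℝ E]

theorem ae_hasDerivAt_inner (hF : AbsolutelyContinuousOnInterval F a b)
    (hG : AbsolutelyContinuousOnInterval G a b) :
    ∀ᵐ t, t ∈ uIcc a b →
      HasDerivAt (fun t => ⟪F t, G t⟫) (⟪F t, deriv G t⟫ + ⟪deriv F t, G t⟫) t := by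
  filter_upwards [hF.boundedVariationOn.ae_differentiableAt_of_mem_uIcc,
    hG.boundedVariationOn.ae_differentiableAt_of_mem_uIcc] with t hFt hGt ht
  exact (hFt ht).hasDerivAt.inner ℝ (hGt ht).hasDerivAt

theorem intervalIntegrable_inner_deriv_add (hF : AbsolutelyContinuousOnInterval F a b)
    (hG : AbsolutelyContinuousOnInterval G a b) :
    IntervalIntegrable (fun t => ⟪F t, deriv G t⟫ + ⟪deriv F t, G t⟫) volume a b :=
  (absolutelyContinuousOnInterval_inner hF hG).intervalIntegrable_deriv.congr_ae <|
    (ae_restrict_iff' measurableSet_uIoc).2 <| (ae_hasDerivAt_inner hF hG).mono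
      fun _ h ht => (h (uIoc_subset_uIcc ht)).deriv

theorem integral_inner_deriv_add (hF : AbsolutelyContinuousOnInterval F a b)
    (hG : AbsolutelyContinuousOnInterval G a b) :
    ∫ t in a..b, (⟪F t, deriv G t⟫ + ⟪deriv F t, G t⟫) = ⟪F b, G b⟫ - ⟪F a, G a⟫ := by
  rw [← (absolutelyContinuousOnInterval_inner hF hG).integral_deriv_eq_sub]
  exact intervalIntegral.integral_congr_ae <| (ae_hasDerivAt_inner hF hG).mono
    fun _ h ht => (h (uIoc_subset_uIcc ht)).deriv.symm

theorem integral_two_mul_inner_deriv (hF : AbsolutelyContinuousOnInterval F a b) :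
    ∫ t in a..b, 2 * ⟪F t, deriv F t⟫ = ‖F b‖ ^ 2 - ‖F a‖ ^ 2 := by
  simpa only [real_inner_self_eq_norm_sq, real_inner_comm, ← two_mul]
    using integral_inner_deriv_add hF hF

end AbsolutelyContinuous

section Wirtinger

variable {E : Type*} [NormedAddCommGroup E] [InnerProductSpace ℝ E] [FiniteDimensional ℝ E]
  {F : ℝ → E} {a b : ℝ}

theorem sub_add_mul_integral_norm_sq_le_of_riccati (hab : a ≤ b)
    (hF : AbsolutelyContinuousOnInterval F a b) {w : ℝ → ℝ}
    (hw : AbsolutelyContinuousOnInterval w a b) {κ : ℝ}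
    (hriccati : ∀ᵐ t, t ∈ Icc a b → deriv w t + w t ^ 2 ≤ -κ)
    (hint : IntervalIntegrable (fun t => ‖deriv F t‖ ^ 2) volume a b) :
    w b * ‖F b‖ ^ 2 - w a * ‖F a‖ ^ 2 + κ * ∫ t in a..b, ‖F t‖ ^ 2 ≤
      ∫ t in a..b, ‖deriv F t‖ ^ 2 := by
  have hN : AbsolutelyContinuousOnInterval (fun t => ‖F t‖ ^ 2) a b := by
    simpa only [real_inner_self_eq_norm_sq] using absolutelyContinuousOnInterval_inner hF hF
  have hwN := hw.fun_mul hN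
  have hNint : IntervalIntegrable (fun t => κ * ‖F t‖ ^ 2) volume a b :=
    hN.continuousOn.intervalIntegrable.const_mul κ
  have hle : ∫ t in a..b, deriv (fun t => w t * ‖F t‖ ^ 2) t ≤
      ∫ t in a..b, (‖deriv F t‖ ^ 2 - κ * ‖F t‖ ^ 2) := by
    refine intervalIntegral.integral_mono_ae_restrict hab hwN.intervalIntegrable_deriv
      (hint.sub hNint) ?_
    rw [← uIcc_of_le hab] at hriccati ⊢
    filter_upwards [ae_restrict_mem measurableSet_uIcc, ae_restrict_of_ae hriccati,
      ae_restrict_of_ae hF.boundedVariationOn.ae_differentiableAt_of_mem_uIcc,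
      ae_restrict_of_ae hw.boundedVariationOn.ae_differentiableAt_of_mem_uIcc] with t ht hr hFt hwt
    rw [((hwt ht).hasDerivAt.fun_mul (hFt ht).hasDerivAt.norm_sq).deriv]
    -- Picone's argument: `(w ‖F‖²)' = w' ‖F‖² + 2 w ⟪F, F'⟫`, and the square absorbs the
    -- cross term.
    have hsq : 0 ≤ ‖deriv F t - w t • F t‖ ^ 2 := sq_nonneg _
    rw [norm_sub_sq_real, real_inner_smul_right, norm_smul, mul_pow, norm_eq_abs, sq_abs,
      real_inner_comm] at hsq
    nlinarith [hr ht, sq_nonneg ‖F t‖]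
  rw [intervalIntegral.integral_sub hint hNint, intervalIntegral.integral_const_mul,
    hwN.integral_deriv_eq_sub] at hle
  linarith

theorem hasDerivAt_mul_tan_mul_sub {k m t : ℝ} (ht : cos (k * (m - t)) ≠ 0) :
    HasDerivAt (fun t => k * tan (k * (m - t))) (-k ^ 2 - (k * tan (k * (m - t))) ^ 2) t := by
  have hlin : HasDerivAt (fun t => k * (m - t)) (-k) t := by
    simpa using ((hasDerivAt_id t).const_sub m).const_mul k
  refine (((hasDerivAt_tan ht).comp t hlin).const_mul k).congr_deriv ?_
  rw [one_div, ← inv_one_add_tan_sq ht, inv_inv]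
  ring

theorem absolutelyContinuousOnInterval_mul_tan_mul_sub {k m : ℝ}
    (h : ∀ t ∈ uIcc a b, cos (k * (m - t)) ≠ 0) :
    AbsolutelyContinuousOnInterval (fun t => k * tan (k * (m - t))) a b := by
  refine ContDiffOn.absolutelyContinuousOnInterval fun t ht => ?_
  exact (contDiffAt_const.mul ((contDiffAt_tan.2 (h t ht)).comp t
    (contDiffAt_const.mul (contDiffAt_const.sub contDiffAt_id)))).contDiffWithinAt

theorem sq_mul_integral_norm_sq_le (hab : a ≤ b) (hF : AbsolutelyContinuousOnInterval F a b)
    (h0 : F a = 0 ∨ F b = 0) (hint : IntervalIntegrable (fun t => ‖deriv F t‖ ^ 2) volume a b)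
    {k : ℝ} (hk : 0 ≤ k) (hkab : k * (b - a) < π / 2) :
    k ^ 2 * ∫ t in a..b, ‖F t‖ ^ 2 ≤ ∫ t in a..b, ‖deriv F t‖ ^ 2 := by
  -- The tangent weight vanishes at the end `m` of the interval opposite to the zero of `F`.
  obtain ⟨m, hm, hbdry⟩ : ∃ m ∈ Icc a b,
      k * tan (k * (m - b)) * ‖F b‖ ^ 2 - k * tan (k * (m - a)) * ‖F a‖ ^ 2 = 0 := by
    rcases h0 with h | h
    · exact ⟨b, right_mem_Icc.2 hab, by simp [h]⟩
    · exact ⟨a, left_mem_Icc.2 hab, by simp [h]⟩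
  have hcos : ∀ t ∈ Icc a b, cos (k * (m - t)) ≠ 0 := fun t ht => by
    have h₁ : k * (m - t) ≤ k * (b - a) := mul_le_mul_of_nonneg_left (by linarith [hm.2, ht.1]) hk
    have h₂ : k * (t - m) ≤ k * (b - a) := mul_le_mul_of_nonneg_left (by linarith [hm.1, ht.2]) hk
    exact (cos_pos_of_mem_Ioo ⟨by linarith, by linarith⟩).ne'
  have hpicone := sub_add_mul_integral_norm_sq_le_of_riccati hab hF
    (absolutelyContinuousOnInterval_mul_tan_mul_sub (by rwa [uIcc_of_le hab]))
    (Eventually.of_forall fun t ht => by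
      rw [(hasDerivAt_mul_tan_mul_sub (hcos t ht)).deriv, sub_add_cancel]) hint
  rwa [hbdry, zero_add] at hpicone

theorem integral_norm_sq_le_mul_integral_norm_deriv_sq (hab : a ≤ b)
    (hF : AbsolutelyContinuousOnInterval F a b) (h0 : F a = 0 ∨ F b = 0)
    (hint : IntervalIntegrable (fun t => ‖deriv F t‖ ^ 2) volume a b) :
    ∫ t in a..b, ‖F t‖ ^ 2 ≤ (2 * (b - a) / π) ^ 2 * ∫ t in a..b, ‖deriv F t‖ ^ 2 := by
  rcases hab.eq_or_lt with rfl | hlt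
  · simp
  have hlen : 0 < b - a := sub_pos.2 hlt
  have hlim : Tendsto (fun k : ℝ => k ^ 2 * ∫ t in a..b, ‖F t‖ ^ 2) (𝓝[<] (π / (2 * (b - a))))
      (𝓝 ((π / (2 * (b - a))) ^ 2 * ∫ t in a..b, ‖F t‖ ^ 2)) :=
    tendsto_nhdsWithin_of_tendsto_nhds (Continuous.tendsto (by fun_prop) _)
  have hle : (π / (2 * (b - a))) ^ 2 * ∫ t in a..b, ‖F t‖ ^ 2 ≤ ∫ t in a..b, ‖deriv F t‖ ^ 2 := by
    refine le_of_tendsto hlim ?_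
    filter_upwards [Ioo_mem_nhdsLT (show 0 < π / (2 * (b - a)) by positivity)] with k hk
    refine sq_mul_integral_norm_sq_le hab hF h0 hint hk.1.le ?_
    calc k * (b - a) < π / (2 * (b - a)) * (b - a) := mul_lt_mul_of_pos_right hk.2 hlen
      _ = π / 2 := by field_simp
  rwa [← inv_div, inv_pow, ← div_eq_inv_mul, le_div_iff₀ (by positivity), mul_comm]

theorem setLIntegral_enorm_sq_le_mul_setLIntegral_enorm_deriv_sq
    (hF : AbsolutelyContinuousOnInterval F a b) (h0 : F a = 0 ∨ F b = 0) :
    ∫⁻ t in Ico a b, ‖F t‖ₑ ^ 2 ≤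
      ENNReal.ofReal ((2 * (b - a) / π) ^ 2) * ∫⁻ t in Ico a b, ‖deriv F t‖ₑ ^ 2 := by
  rcases le_or_gt b a with hba | hlt
  · simp [Ico_eq_empty_of_le hba]
  rcases eq_or_ne (∫⁻ t in Ico a b, ‖deriv F t‖ₑ ^ 2) ⊤ with htop | hfin
  · have : 0 < b - a := sub_pos.2 hlt
    rw [htop, ENNReal.mul_top (ENNReal.ofReal_pos.2 (by positivity)).ne']
    exact le_top
  have lintegral_eq {K : ℝ → E} (hK : IntervalIntegrable (fun t => ‖K t‖ ^ 2) volume a b) :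
      ∫⁻ t in Ico a b, ‖K t‖ₑ ^ 2 = ENNReal.ofReal (∫ t in a..b, ‖K t‖ ^ 2) := by
    rw [intervalIntegral.integral_of_le hlt.le, setLIntegral_congr Ico_ae_eq_Ioc,
      ofReal_integral_eq_lintegral_ofReal hK.1 (Eventually.of_forall fun t => sq_nonneg _)]
    simp only [ENNReal.ofReal_pow (norm_nonneg _), ofReal_norm]
  have hint : IntervalIntegrable (fun t => ‖deriv F t‖ ^ 2) volume a b := by
    rw [intervalIntegrable_iff_integrableOn_Ico_of_le hlt.le]
    refine ⟨((aestronglyMeasurable_deriv F _).norm.pow 2), ?_⟩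
    simpa only [HasFiniteIntegral, enorm_pow, enorm_norm] using hfin.lt_top
  rw [lintegral_eq hint, lintegral_eq (hF.continuousOn.norm.pow 2).intervalIntegrable,
    ← ENNReal.ofReal_mul (sq_nonneg _)]
  exact ENNReal.ofReal_le_ofReal
    (integral_norm_sq_le_mul_integral_norm_deriv_sq hlt.le hF h0 hint)

end Wirtinger

section Energy

variable {E : Type*} [NormedAddCommGroup E] [InnerProductSpace ℝ E]

/-- The quadratic form `∫_s p |F'|²` of the Sturm-Liouville expression `-(p F')'`, as an element of
`[0, ∞]`, so that no integrability has to be assumed. -/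
noncomputable def energy (p : ℝ → ℝ) (F : ℝ → E) (s : Set ℝ) : ℝ≥0∞ :=
  ∫⁻ t in s, ENNReal.ofReal (p t) * ‖deriv F t‖ₑ ^ 2

variable {p : ℝ → ℝ} {F G : ℝ → E}

theorem ae_ofReal_mul_enorm_deriv_sq_eq (hp : ∀ t, 0 ≤ p t)
    (hG : G =ᵐ[volume] fun t => p t • deriv F t) :
    ∀ᵐ t, 0 ≤ ⟪deriv F t, G t⟫ ∧
      ENNReal.ofReal (p t) * ‖deriv F t‖ₑ ^ 2 = ENNReal.ofReal ⟪deriv F t, G t⟫ := by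
  filter_upwards [hG] with t ht
  rw [ht, real_inner_smul_right, real_inner_self_eq_norm_sq, ENNReal.ofReal_mul (hp t),
    ENNReal.ofReal_pow (norm_nonneg _), ofReal_norm]
  exact ⟨mul_nonneg (hp t) (sq_nonneg _), rfl⟩

variable [FiniteDimensional ℝ E] {a b : ℝ}

theorem setLIntegral_enorm_sub_sq_le_energy (hF : AbsolutelyContinuousOnInterval F a b) {c : E}
    (hc : F a = c ∨ F b = c) {q δ : ℝ} (hq : ∀ t ∈ Ico a b, q ^ 2 ≤ p t)
    (hlen : 2 * (b - a) ≤ δ * q) :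
    ∫⁻ t in Ico a b, ‖F t - c‖ₑ ^ 2 ≤ ENNReal.ofReal ((δ / π) ^ 2) * energy p F (Ico a b) := by
  rcases lt_or_ge b a with hba | hab
  · simp [Ico_eq_empty_of_le hba.le]
  have hconst : (2 * (b - a) / π) ^ 2 ≤ (δ / π) ^ 2 * q ^ 2 := by
    rw [← mul_pow, div_mul_eq_mul_div]
    have := sub_nonneg.2 hab
    gcongr
  calc ∫⁻ t in Ico a b, ‖F t - c‖ₑ ^ 2
      ≤ ENNReal.ofReal ((2 * (b - a) / π) ^ 2) * ∫⁻ t in Ico a b, ‖deriv F t‖ₑ ^ 2 := by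
        simpa only [deriv_sub_const_fun] using
          setLIntegral_enorm_sq_le_mul_setLIntegral_enorm_deriv_sq
            (absolutelyContinuousOnInterval_sub_const hF c) (by simpa only [sub_eq_zero] using hc)
    _ ≤ ENNReal.ofReal ((δ / π) ^ 2 * q ^ 2) * ∫⁻ t in Ico a b, ‖deriv F t‖ₑ ^ 2 := by gcongr
    _ = ENNReal.ofReal ((δ / π) ^ 2) *
          ∫⁻ t in Ico a b, ENNReal.ofReal (q ^ 2) * ‖deriv F t‖ₑ ^ 2 := by
        rw [ENNReal.ofReal_mul (sq_nonneg _), mul_assoc,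
          lintegral_const_mul' _ _ ENNReal.ofReal_ne_top]
    _ ≤ ENNReal.ofReal ((δ / π) ^ 2) * energy p F (Ico a b) := by
        refine mul_le_mul_right (setLIntegral_mono_ae' measurableSet_Ico ?_) _
        filter_upwards with t ht
        gcongr
        exact hq t ht

variable (hp : ∀ t, 0 ≤ p t) (hG : G =ᵐ[volume] fun t => p t • deriv F t)

include hp hG

theorem energy_Ioc (hab : a ≤ b) (hFac : AbsolutelyContinuousOnInterval F a b)
    (hGac : AbsolutelyContinuousOnInterval G a b)
    (hint : IntervalIntegrable (fun t => ⟪F t, deriv G t⟫) volume a b) :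
    energy p F (Ioc a b) =
      ENNReal.ofReal (⟪F b, G b⟫ - ⟪F a, G a⟫ - ∫ t in a..b, ⟪F t, deriv G t⟫) := by
  have hdensity := ae_restrict_of_ae (s := Ioc a b) (ae_ofReal_mul_enorm_deriv_sq_eq hp hG)
  have hsum := intervalIntegrable_inner_deriv_add hFac hGac
  have hF'G : IntervalIntegrable (fun t => ⟪deriv F t, G t⟫) volume a b := by
    simpa only [add_sub_cancel_left] using hsum.sub hint
  rw [energy, lintegral_congr_ae (hdensity.mono fun _ h => h.2),
    ← ofReal_integral_eq_lintegral_ofReal hF'G.1 (hdensity.mono fun _ h => h.1),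
    ← intervalIntegral.integral_of_le hab, ← integral_inner_deriv_add hFac hGac,
    ← intervalIntegral.integral_sub hsum hint]
  simp only [add_sub_cancel_left]

variable (hFac : ∀ a b, AbsolutelyContinuousOnInterval F a b)

include hFac

theorem exists_ge_inner_nonpos {r : ℝ≥0∞} (hr₀ : r ≠ 0) (hr : r ≠ ⊤) (hFr : MemLp F r) (T : ℝ) :
    ∃ b, T ≤ b ∧ ⟪F b, G b⟫ ≤ 0 := by
  -- Otherwise `‖F‖` is nondecreasing on `[T, ∞)`.
  by_contra! hpos
  have hFT : ‖F T‖₊ ≠ 0 := fun h => by simpa [nnnorm_eq_zero.1 h] using hpos T le_rfl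
  refine (hFr.meas_ge_lt_top hr₀ hr hFT).not_ge
    ((Real.volume_Ici (a := T)).ge.trans (measure_mono fun t ht => ?_))
  have hderiv : 0 ≤ ∫ s in T..t, 2 * ⟪F s, deriv F s⟫ := by
    refine intervalIntegral.integral_nonneg_of_ae_restrict ht ?_
    filter_upwards [ae_restrict_mem measurableSet_Icc, ae_restrict_of_ae hG] with s hs hGs
    have := hpos s hs.1
    rw [hGs, real_inner_smul_right] at this
    exact mul_nonneg zero_le_two (pos_of_mul_pos_right this (hp s)).le
  rw [integral_two_mul_inner_deriv (hFac T t), sub_nonneg] at hderiv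
  exact (sq_le_sq₀ (norm_nonneg _) (norm_nonneg _)).1 hderiv

theorem exists_le_inner_nonneg {r : ℝ≥0∞} (hr₀ : r ≠ 0) (hr : r ≠ ⊤) (hFr : MemLp F r) (T : ℝ) :
    ∃ a, a ≤ T ∧ 0 ≤ ⟪F a, G a⟫ := by
  by_contra! hneg
  have hFT : ‖F T‖₊ ≠ 0 := fun h => by simpa [nnnorm_eq_zero.1 h] using hneg T le_rfl
  refine (hFr.meas_ge_lt_top hr₀ hr hFT).not_ge
    ((Real.volume_Iic (a := T)).ge.trans (measure_mono fun t ht => ?_))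
  have hderiv : 0 ≤ ∫ s in t..T, -(2 * ⟪F s, deriv F s⟫) := by
    refine intervalIntegral.integral_nonneg_of_ae_restrict ht ?_
    filter_upwards [ae_restrict_mem measurableSet_Icc, ae_restrict_of_ae hG] with s hs hGs
    have := hneg s hs.2
    rw [hGs, real_inner_smul_right] at this
    exact neg_nonneg.2
      (mul_nonpos_of_nonneg_of_nonpos zero_le_two (neg_of_mul_neg_right this (hp s)).le)
  rw [intervalIntegral.integral_neg, integral_two_mul_inner_deriv (hFac t T), neg_sub,
    sub_nonneg] at hderiv
  exact (sq_le_sq₀ (norm_nonneg _) (norm_nonneg _)).1 hderiv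

theorem energy_univ_le (hGac : ∀ a b, AbsolutelyContinuousOnInterval G a b)
    {r : ℝ≥0∞} (hr₀ : r ≠ 0) (hr : r ≠ ⊤) (hFr : MemLp F r)
    (hint : Integrable fun t => ⟪F t, deriv G t⟫) :
    energy p F univ ≤ ENNReal.ofReal (-∫ t, ⟪F t, deriv G t⟫) := by
  choose a haT ha using fun n : ℕ =>
    exists_le_inner_nonneg hp hG hFac hr₀ hr hFr (-(n : ℝ))
  choose b hbT hb using fun n : ℕ => exists_ge_inner_nonpos hp hG hFac hr₀ hr hFr (n : ℝ)
  have hab (n : ℕ) : a n ≤ b n := by linarith [haT n, hbT n, n.cast_nonneg (α := ℝ)]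
  have hcover : AECover (volume : Measure ℝ) atTop fun n => Ioc (a n) (b n) :=
    aecover_Ioc
      (tendsto_atBot_mono haT (tendsto_neg_atTop_atBot.comp tendsto_natCast_atTop_atTop))
      (tendsto_atTop_mono hbT tendsto_natCast_atTop_atTop)
  have hmeas : AEMeasurable fun t => ENNReal.ofReal (p t) * ‖deriv F t‖ₑ ^ 2 := by
    have hGm := (continuous_of_forall_absolutelyContinuousOnInterval hGac).aestronglyMeasurable
      (μ := volume)
    exact ((aestronglyMeasurable_deriv F volume).inner hGm).aemeasurable.ennreal_ofReal.congr
      ((ae_ofReal_mul_enorm_deriv_sq_eq hp hG).mono fun _ h => h.2.symm)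
  have henergy : Tendsto (fun n => energy p F (Ioc (a n) (b n))) atTop (𝓝 (energy p F univ)) := by
    rw [energy, Measure.restrict_univ]
    exact hcover.lintegral_tendsto_of_countably_generated hmeas
  refine le_of_tendsto_of_tendsto' henergy ((ENNReal.continuous_ofReal.tendsto _).comp
    (hcover.integral_tendsto_of_countably_generated hint).neg) fun n => ?_
  rw [energy_Ioc hp hG (hab n) (hFac _ _) (hGac _ _) hint.intervalIntegrable,
    intervalIntegral.integral_of_le (hab n)]
  exact ENNReal.ofReal_le_ofReal (by linarith [ha n, hb n])

end Energy

theorem SLRel.exists_energy_le {p : ℝ → ℝ} (hp : ∀ t, 0 ≤ p t) {f g : L2R} (h : SLRel p f g) :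
    ∃ F, ACLoc F ∧ f =ᵐ[volume] F ∧ energy p F univ ≤ ENNReal.ofReal (inner ℂ f g).re := by
  obtain ⟨F, G, hFac, hGac, hf, hG, hg⟩ := h
  have hinner : (fun t => (inner ℂ (f t) (g t)).re) =ᵐ[volume] fun t => -⟪F t, deriv G t⟫ := by
    filter_upwards [hf, hg] with t hft hgt
    rw [hft, hgt, inner_neg_right, Complex.neg_re, real_inner_eq_re_inner ℂ]
    rfl
  have hint : Integrable fun t => inner ℂ (f t) (g t) := L2.integrable_inner f g
  refine ⟨F, hFac, hf, ?_⟩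
  calc energy p F univ ≤ ENNReal.ofReal (-∫ t, ⟪F t, deriv G t⟫) := by
        refine energy_univ_le hp (by simpa only [Complex.real_smul] using hG) hFac hGac
          two_ne_zero ENNReal.ofNat_ne_top ((Lp.memLp f).ae_eq hf) ?_
        exact integrable_neg_iff.1 (hint.re.congr hinner)
    _ = ENNReal.ofReal (inner ℂ f g).re := by
        rw [← integral_neg, ← integral_congr_ae hinner, L2.inner_def]
        exact congrArg ENNReal.ofReal (integral_re hint)

section SpectralMeasure

variable {H : Type*} [NormedAddCommGroup H] [InnerProductSpace ℂ H] [CompleteSpace H]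

namespace ProjectionValuedMeasure

variable (E : ProjectionValuedMeasure H) (f : H)

theorem scalarMeasure_apply {S : Set ℝ} (hS : MeasurableSet S) :
    E.scalarMeasure f S = ENNReal.ofReal (inner ℂ f (E.proj S f)).re :=
  Measure.ofMeasurable_apply S hS

theorem scalarMeasure_univ : E.scalarMeasure f Set.univ = ENNReal.ofReal (‖f‖ ^ 2) := by
  rw [E.scalarMeasure_apply f MeasurableSet.univ, E.univ]
  exact congrArg ENNReal.ofReal (inner_self_eq_norm_sq (𝕜 := ℂ) f)

instance : IsFiniteMeasure (E.scalarMeasure f) :=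
  ⟨(E.scalarMeasure_univ f).trans_lt ENNReal.ofReal_lt_top⟩

variable {E f} {S : Set ℝ}

theorem ae_mem_scalarMeasure (hS : MeasurableSet S) (hf : E.proj S f = f) :
    ∀ᵐ l ∂E.scalarMeasure f, l ∈ S := by
  have hcompl : E.proj Sᶜ f = 0 := by
    rw [← hf, ← mul_apply_eq_comp, ← E.inter _ _ hS.compl hS, Set.compl_inter_self,
      E.empty, zero_apply]
  change E.scalarMeasure f Sᶜ = 0
  rw [E.scalarMeasure_apply f hS.compl, hcompl, inner_zero_right, Complex.zero_re,
    ENNReal.ofReal_zero]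

namespace IsSpectralMeasureOf

variable {A : H →ₗ.[ℂ] H} (hE : E.IsSpectralMeasureOf A)

include hE

theorem integrable_id (hf : f ∈ A.domain) : Integrable id (E.scalarMeasure f) := by
  have hsq : Integrable (fun l : ℝ => l ^ 2) (E.scalarMeasure f) :=
    ⟨by fun_prop, (hasFiniteIntegral_iff_ofReal (Eventually.of_forall sq_nonneg)).2
      ((hE.mem_domain_iff f).1 hf)⟩
  exact ((memLp_two_iff_integrable_sq aestronglyMeasurable_id).2 hsq).integrable one_le_two

theorem mem_domain_of_isBounded (hS : MeasurableSet S) (hSb : Bornology.IsBounded S)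
    (hf : E.proj S f = f) : f ∈ A.domain := by
  obtain ⟨r, hr⟩ := hSb.exists_norm_le
  rw [hE.mem_domain_iff]
  calc ∫⁻ l, ENNReal.ofReal (l ^ 2) ∂E.scalarMeasure f
      ≤ ∫⁻ _, ENNReal.ofReal (r ^ 2) ∂E.scalarMeasure f := by
        refine lintegral_mono_ae ((ae_mem_scalarMeasure hS hf).mono fun l hl => ?_)
        exact ENNReal.ofReal_le_ofReal (sq_le_sq' (abs_le.1 (hr l hl)).1 (abs_le.1 (hr l hl)).2)
    _ < ⊤ := by
        rw [lintegral_const]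
        exact ENNReal.mul_lt_top ENNReal.ofReal_lt_top (measure_lt_top _ _)

theorem re_inner_apply_le {Ω : ℝ} (hS : MeasurableSet S) (hSΩ : S ⊆ Iic Ω) {f : A.domain}
    (hf : E.proj S f = f) : (inner ℂ (f : H) (A f)).re ≤ Ω * ‖(f : H)‖ ^ 2 := by
  rw [hE.inner_apply, Complex.ofReal_re]
  calc ∫ l, l ∂E.scalarMeasure f ≤ ∫ _, Ω ∂E.scalarMeasure f :=
        integral_mono_ae (hE.integrable_id f.2) (integrable_const _)
          ((ae_mem_scalarMeasure hS hf).mono hSΩ)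
    _ = Ω * ‖(f : H)‖ ^ 2 := by
        rw [integral_const, Measure.real, E.scalarMeasure_univ,
          ENNReal.toReal_ofReal (sq_nonneg _), smul_eq_mul, mul_comm]

end IsSpectralMeasureOf

end ProjectionValuedMeasure

theorem spectralProjection_eq_proj_or_eq_zero (A : H →ₗ.[ℂ] H) :
    (∃ E : ProjectionValuedMeasure H, E.IsSpectralMeasureOf A ∧ spectralProjection A = E.proj) ∨
      spectralProjection A = 0 := by
  by_cases h : ∃ E : ProjectionValuedMeasure H, E.IsSpectralMeasureOf A
  · exact Or.inl ⟨h.choose, h.choose_spec, funext fun S => dif_pos h⟩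
  · exact Or.inr (funext fun S => dif_neg h)

theorem isStarProjection_spectralProjection (A : H →ₗ.[ℂ] H) {S : Set ℝ} (hS : MeasurableSet S) :
    IsStarProjection (spectralProjection A S) := by
  rcases spectralProjection_eq_proj_or_eq_zero A with ⟨E, -, hE⟩ | h
  · exact hE ▸ E.isStarProjection S hS
  · exact h ▸ IsStarProjection.zero _

theorem exists_mem_graph_re_inner_le {A : H →ₗ.[ℂ] H} {S : Set ℝ} {Ω : ℝ} (hS : MeasurableSet S)
    (hSb : Bornology.IsBounded S) (hSΩ : S ⊆ Iic Ω) {f : H} (hf : spectralProjection A S f = f) :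
    ∃ g, (f, g) ∈ A.graph ∧ (inner ℂ f g).re ≤ Ω * ‖f‖ ^ 2 := by
  rcases spectralProjection_eq_proj_or_eq_zero A with ⟨E, hEA, hE⟩ | h
  · rw [hE] at hf
    have hdom := hEA.mem_domain_of_isBounded hS hSb hf
    exact ⟨A ⟨f, hdom⟩, A.mem_graph ⟨f, hdom⟩, hEA.re_inner_apply_le hS hSΩ (f := ⟨f, hdom⟩) hf⟩
  · obtain rfl : f = 0 := by rw [← hf, h]; rfl
    exact ⟨0, A.graph.zero_mem, by simp⟩

end SpectralMeasure

section PaleyWiener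

variable {p : ℝ → ℝ} {L : Set ℝ}

theorem mem_PW_iff {f : L2R} : f ∈ PW p L ↔ pwProj p L f = f := eq_comm

theorem sub_mem_PW {f g : L2R} (hf : f ∈ PW p L) (hg : g ∈ PW p L) : f - g ∈ PW p L := by
  rw [mem_PW_iff] at *
  rw [map_sub, hf, hg]

theorem pwProj_mem_PW (hL : MeasurableSet L) (u : L2R) : pwProj p L u ∈ PW p L :=
  mem_PW_iff.2 <| DFunLike.congr_fun
    (isStarProjection_spectralProjection (slOperator p) hL).isIdempotentElem u

theorem norm_pwProj_le (hL : MeasurableSet L) (u : L2R) : ‖pwProj p L u‖ ≤ ‖u‖ := by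
  simpa only [one_mul] using (pwProj p L).le_of_opNorm_le
    (isStarProjection_spectralProjection (slOperator p) hL).norm_le u

theorem exists_energy_le_of_mem_PW (hp : ∀ t, 0 ≤ p t) {Ω : ℝ} (hL : MeasurableSet L)
    (hLb : Bornology.IsBounded L) (hLΩ : L ⊆ Iic Ω) {f : L2R} (hf : f ∈ PW p L) :
    ∃ F, ACLoc F ∧ f =ᵐ[volume] F ∧ energy p F univ ≤ ENNReal.ofReal (Ω * ‖f‖ ^ 2) := by
  obtain ⟨g, hfg, hle⟩ := exists_mem_graph_re_inner_le hL hLb hLΩ (mem_PW_iff.1 hf)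
  obtain ⟨F, hFac, hfF, hF⟩ := ((mem_graph_slOperator p f g).1 hfg).exists_energy_le hp
  exact ⟨F, hFac, hfF, hF.trans (ENNReal.ofReal_le_ofReal hle)⟩

end PaleyWiener

section Cells

variable {x : ℤ → ℝ}

/-- The interval `[y_{i-1}, y_i)` of the points nearest to `x_i`, that is, the support of `χ_i`. -/
def cell (x : ℤ → ℝ) (i : ℤ) : Set ℝ := Ico (midpt x (i - 1)) (midpt x i)

theorem measurableSet_cell (x : ℤ → ℝ) (i : ℤ) : MeasurableSet (cell x i) := measurableSet_Ico

theorem chi_eq_indicator_cell (x : ℤ → ℝ) (i : ℤ) : chi x i = (cell x i).indicator 1 := rfl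

theorem iUnion_Ico_pred_eq_univ {α : Type*} [LinearOrder α] [NoMaxOrder α] {y : ℤ → α}
    (hy_top : Tendsto y atTop atTop) (hy_bot : Tendsto y atBot atBot) :
    ⋃ i, Ico (y (i - 1)) (y i) = univ := by
  refine eq_univ_of_forall fun t => mem_iUnion.2 ?_
  obtain ⟨m, hm⟩ := eventually_atBot.1 (hy_bot.eventually_le_atBot t)
  obtain ⟨i, hi, hmin⟩ := Int.exists_least_of_bdd (P := fun i => t < y i)
    ⟨m, fun i hi => le_of_not_ge fun him => (hm i him).not_gt hi⟩
    (hy_top.eventually_gt_atTop t).exists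
  exact ⟨i, not_lt.1 fun h => (hmin _ h).not_gt (sub_one_lt i), hi⟩

section Monotone

variable (hx : Monotone x)

include hx

theorem monotone_midpt : Monotone (midpt x) := fun i j hij => by
  have hle := hx hij
  have hle_succ := hx (add_le_add_left hij 1)
  unfold midpt
  linarith

theorem pairwise_disjoint_cell : Pairwise (Function.onFun Disjoint (cell x)) :=
  (monotone_midpt hx).pairwise_disjoint_on_Ico_pred

theorem le_midpt (i : ℤ) : x i ≤ midpt x i := by
  have := hx (lt_add_one i).le
  unfold midpt
  linarith

theorem midpt_le (i : ℤ) : midpt x i ≤ x (i + 1) := by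
  have := hx (lt_add_one i).le
  unfold midpt
  linarith

theorem midpt_pred_le (i : ℤ) : midpt x (i - 1) ≤ x i := by
  simpa only [sub_add_cancel] using midpt_le hx (i - 1)

theorem weightedGap_nonneg (p : ℝ → ℝ) (i : ℤ) : 0 ≤ weightedGap p x i :=
  div_nonneg (sub_nonneg.2 (hx (lt_add_one i).le)) (Real.iInf_nonneg fun _ => sqrt_nonneg _)

theorem stepFun_eq_of_mem_cell (c : ℤ → ℂ) {i : ℤ} {t : ℝ} (ht : t ∈ cell x i) :
    stepFun x c t = c i := by
  have hzero (j : ℤ) (hj : j ≠ i) : c j * chi x j t = 0 := by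
    have htj : t ∉ cell x j := fun h => disjoint_left.1 (pairwise_disjoint_cell hx hj) h ht
    rw [chi_eq_indicator_cell, indicator_of_notMem htj, mul_zero]
  rw [stepFun, tsum_eq_single i hzero, chi_eq_indicator_cell, indicator_of_mem ht, Pi.one_apply,
    mul_one]

end Monotone

section Cover

variable (hx : Monotone x) (hx_top : Tendsto x atTop atTop) (hx_bot : Tendsto x atBot atBot)

include hx hx_top hx_bot

theorem iUnion_cell : ⋃ i, cell x i = univ :=
  iUnion_Ico_pred_eq_univ (tendsto_atTop_mono (le_midpt hx) hx_top)
    (tendsto_atBot_mono (midpt_le hx)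
      (hx_bot.comp (tendsto_atBot_add_const_right _ 1 tendsto_id)))

theorem lintegral_eq_tsum_cell (u : ℝ → ℝ≥0∞) : ∫⁻ t, u t = ∑' i, ∫⁻ t in cell x i, u t := by
  rw [← lintegral_iUnion (measurableSet_cell x) (pairwise_disjoint_cell hx),
    iUnion_cell hx hx_top hx_bot, Measure.restrict_univ]

theorem aestronglyMeasurable_stepFun (c : ℤ → ℂ) : AEStronglyMeasurable (stepFun x c) volume := by
  rw [← Measure.restrict_univ (μ := volume), ← iUnion_cell hx hx_top hx_bot,
    aestronglyMeasurable_iUnion_iff]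
  refine fun i => aestronglyMeasurable_const.congr (f := fun _ => c i) ?_
  filter_upwards [ae_restrict_mem (measurableSet_cell x i)] with t ht
  exact (stepFun_eq_of_mem_cell hx c ht).symm

theorem stepFun_sub (c d : ℤ → ℂ) : stepFun x (c - d) = stepFun x c - stepFun x d := by
  funext t
  obtain ⟨i, hi⟩ := mem_iUnion.1 ((iUnion_cell hx hx_top hx_bot).ge (mem_univ t))
  simp only [Pi.sub_apply, stepFun_eq_of_mem_cell hx _ hi]

end Cover

end Cells

section SamplingError

variable {p : ℝ → ℝ} {x : ℤ → ℝ}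

theorem iInf_sqrt_le {α : Type*} (u : α → ℝ) {s : Set α} {t : α} (ht : t ∈ s) :
    ⨅ r : s, √(u r) ≤ √(u t) :=
  ciInf_le (f := fun r : s => √(u r)) ⟨0, forall_mem_range.2 fun _ => sqrt_nonneg _⟩ ⟨t, ht⟩

theorem iInf_sqrt_pos {α : Type*} {u : α → ℝ} {s : Set α} (hs : s.Nonempty) {c : ℝ} (hc : 0 < c)
    (hu : ∀ t ∈ s, c ≤ u t) : 0 < ⨅ r : s, √(u r) :=
  have := hs.to_subtype
  (sqrt_pos.2 hc).trans_le (le_ciInf fun r => sqrt_le_sqrt (hu r r.2))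

variable (hinf : ∀ i, 0 < ⨅ t : Icc (x i) (x (i + 1)), √(p t))

include hinf

theorem pos_of_iInf_sqrt_pos (hx_top : Tendsto x atTop atTop) (hx_bot : Tendsto x atBot atBot)
    (t : ℝ) : 0 < p t := by
  obtain ⟨i, hi⟩ := mem_iUnion.1 ((iUnion_Ico_pred_eq_univ hx_top hx_bot).ge (mem_univ t))
  have hi' : t ∈ Icc (x (i - 1)) (x (i - 1 + 1)) := by
    simpa only [sub_add_cancel] using Ico_subset_Icc_self hi
  exact sqrt_pos.1 ((hinf _).trans_le (iInf_sqrt_le p hi'))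

variable (hx : Monotone x) {δ : ℝ} (hδ : ∀ i, weightedGap p x i ≤ δ) {F : ℝ → ℂ} (hF : ACLoc F)

include hx hδ hF

theorem setLIntegral_cell_enorm_sub_sq_le (hp : ∀ t, 0 ≤ p t) (i : ℤ) :
    ∫⁻ t in cell x i, ‖F t - F (x i)‖ₑ ^ 2 ≤
      ENNReal.ofReal ((δ / π) ^ 2) * energy p F (cell x i) := by
  have hgap (j : ℤ) : x (j + 1) - x j ≤ δ * ⨅ t : Icc (x j) (x (j + 1)), √(p t) :=
    (div_le_iff₀ (hinf j)).1 (hδ j)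
  have hq (j : ℤ) {t : ℝ} (ht : t ∈ Icc (x j) (x (j + 1))) :
      (⨅ t : Icc (x j) (x (j + 1)), √(p t)) ^ 2 ≤ p t :=
    (le_sqrt (hinf j).le (hp t)).1 (iInf_sqrt_le p ht)
  have hsplit (u : ℝ → ℝ≥0∞) : ∫⁻ t in cell x i, u t =
      (∫⁻ t in Ico (midpt x (i - 1)) (x i), u t) + ∫⁻ t in Ico (x i) (midpt x i), u t := by
    rw [← lintegral_union measurableSet_Ico Ico_disjoint_Ico_same,
      Ico_union_Ico_eq_Ico (midpt_pred_le hx i) (le_midpt hx i), cell]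
  rw [energy, hsplit, hsplit, mul_add]
  refine add_le_add
    (setLIntegral_enorm_sub_sq_le_energy (hF _ _) (Or.inr rfl) (fun t ht => hq (i - 1) ?_)
      ((le_of_eq ?_).trans (hgap (i - 1))))
    (setLIntegral_enorm_sub_sq_le_energy (hF _ _) (Or.inl rfl) (fun t ht => hq i ?_)
      ((le_of_eq ?_).trans (hgap i)))
  · exact ⟨(le_midpt hx _).trans ht.1, by simpa only [sub_add_cancel] using ht.2.le⟩
  · simp only [midpt, sub_add_cancel]
    ring
  · exact ⟨ht.1, ht.2.le.trans (midpt_le hx i)⟩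
  · rw [midpt]
    ring

theorem lintegral_enorm_sub_stepFun_sq_le (hx_top : Tendsto x atTop atTop)
    (hx_bot : Tendsto x atBot atBot) :
    ∫⁻ t, ‖F t - stepFun x (F ∘ x) t‖ₑ ^ 2 ≤
      ENNReal.ofReal ((δ / π) ^ 2) * energy p F univ := by
  have hp (t : ℝ) := (pos_of_iInf_sqrt_pos hinf hx_top hx_bot t).le
  rw [energy, Measure.restrict_univ, lintegral_eq_tsum_cell hx hx_top hx_bot,
    lintegral_eq_tsum_cell hx hx_top hx_bot, ← ENNReal.tsum_mul_left]
  refine ENNReal.tsum_le_tsum fun i => ?_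
  calc ∫⁻ t in cell x i, ‖F t - stepFun x (F ∘ x) t‖ₑ ^ 2
      = ∫⁻ t in cell x i, ‖F t - F (x i)‖ₑ ^ 2 :=
        setLIntegral_congr_fun (measurableSet_cell x i) fun t ht => by
          rw [stepFun_eq_of_mem_cell hx _ ht, Function.comp_apply]
    _ ≤ ENNReal.ofReal ((δ / π) ^ 2) * energy p F (cell x i) :=
        setLIntegral_cell_enorm_sub_sq_le hinf hx hδ hF hp i

end SamplingError

section SamplesInL2

variable {x : ℤ → ℝ}

theorem pointValue_eq {f : L2R} {F : ℝ → ℂ} (hF : Continuous F) (hf : f =ᵐ[volume] F) :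
    pointValue f = F := by
  have h : HasContRep f := ⟨F, hF, hf⟩
  have hchoose : pointValue f = h.choose := funext fun t => dif_pos h
  rw [hchoose]
  exact (h.choose_spec.1.ae_eq_iff_eq volume hF).1 (h.choose_spec.2.symm.trans hf)

theorem samples_eq {f : L2R} {F : ℝ → ℂ} (hF : Continuous F) (hf : f =ᵐ[volume] F) :
    samples x f = F ∘ x := by
  funext i
  rw [samples, pointValue_eq hF hf, Function.comp_apply]

theorem samples_sub {f g : L2R} (hf : HasContRep f) (hg : HasContRep g) :
    samples x (f - g) = samples x f - samples x g := by
  obtain ⟨F, hF, hfF⟩ := hf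
  obtain ⟨G, hG, hgG⟩ := hg
  rw [samples_eq hF hfF, samples_eq hG hgG,
    samples_eq (hF.sub hG) ((Lp.coeFn_sub f g).trans (hfF.sub hgG))]
  rfl

theorem stepL2_eq_toLp {c : ℤ → ℂ} (hc : MemLp (stepFun x c) 2) :
    stepL2 x c = hc.toLp (stepFun x c) :=
  dif_pos hc

theorem stepL2_sub (hx : Monotone x) (hx_top : Tendsto x atTop atTop)
    (hx_bot : Tendsto x atBot atBot) {c d : ℤ → ℂ} (hc : MemLp (stepFun x c) 2)
    (hd : MemLp (stepFun x d) 2) : stepL2 x (c - d) = stepL2 x c - stepL2 x d := by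
  have hcd := stepFun_sub hx hx_top hx_bot c d
  rw [stepL2_eq_toLp hc, stepL2_eq_toLp hd, stepL2_eq_toLp (hcd ▸ hc.sub hd), ← MemLp.toLp_sub]
  exact MemLp.toLp_congr _ _ (Eventually.of_forall (congrFun hcd))

end SamplesInL2

theorem eLpNorm_two_le_of_lintegral_enorm_sq_le {α E : Type*} [MeasurableSpace α]
    [NormedAddCommGroup E] {μ : Measure α} {u : α → E} {C : ℝ≥0∞}
    (h : ∫⁻ t, ‖u t‖ₑ ^ 2 ∂μ ≤ C ^ 2) : eLpNorm u 2 μ ≤ C := by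
  have hpow := eLpNorm_nnreal_pow_eq_lintegral (f := u) (μ := μ) (p := 2) two_ne_zero
  simp only [NNReal.coe_ofNat, ENNReal.rpow_ofNat, ENNReal.coe_ofNat] at hpow
  exact (ENNReal.pow_le_pow_left_iff two_ne_zero).1 (hpow.trans_le h)

section SamplingOnPaleyWiener

variable {p : ℝ → ℝ} {Ω : ℝ} {L : Set ℝ} {x : ℤ → ℝ} {δ : ℝ} {g : L2R}

theorem hasContRep_of_mem_PW (hp : ∀ t, 0 ≤ p t) (hL : MeasurableSet L)
    (hLb : Bornology.IsBounded L) (hg : g ∈ PW p L) : HasContRep g := by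
  obtain ⟨Ω, hΩ⟩ := hLb.bddAbove
  obtain ⟨F, hF, hgF, -⟩ := exists_energy_le_of_mem_PW hp hL hLb hΩ hg
  exact ⟨F, hF.continuous, hgF⟩

variable (hinf : ∀ i, 0 < ⨅ t : Icc (x i) (x (i + 1)), √(p t)) (hx : Monotone x)
  (hx_top : Tendsto x atTop atTop) (hx_bot : Tendsto x atBot atBot)
  (hδ : ∀ i, weightedGap p x i ≤ δ) (hL : MeasurableSet L) (hLb : Bornology.IsBounded L)
  (hΩ : 0 ≤ Ω) (hLΩ : L ⊆ Iic Ω) (hg : g ∈ PW p L)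

include hinf hx hx_top hx_bot hδ hL hLb hΩ hLΩ hg

theorem eLpNorm_sub_stepFun_samples_le :
    eLpNorm (⇑g - stepFun x (samples x g)) 2 volume ≤ ENNReal.ofReal (δ * √Ω / π * ‖g‖) := by
  obtain ⟨F, hF, hgF, henergy⟩ := exists_energy_le_of_mem_PW
    (fun t => (pos_of_iInf_sqrt_pos hinf hx_top hx_bot t).le) hL hLb hLΩ hg
  have hδ₀ : 0 ≤ δ := (weightedGap_nonneg hx p 0).trans (hδ 0)
  rw [samples_eq hF.continuous hgF,
    eLpNorm_congr_ae (hgF.sub (ae_eq_refl (stepFun x (F ∘ x))))]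
  refine eLpNorm_two_le_of_lintegral_enorm_sq_le ?_
  calc ∫⁻ t, ‖F t - stepFun x (F ∘ x) t‖ₑ ^ 2
      ≤ ENNReal.ofReal ((δ / π) ^ 2) * energy p F univ :=
        lintegral_enorm_sub_stepFun_sq_le hinf hx hδ hF hx_top hx_bot
    _ ≤ ENNReal.ofReal ((δ / π) ^ 2) * ENNReal.ofReal (Ω * ‖g‖ ^ 2) := by gcongr
    _ = ENNReal.ofReal (δ * √Ω / π * ‖g‖) ^ 2 := by
        rw [← ENNReal.ofReal_mul (sq_nonneg _), ← ENNReal.ofReal_pow (by positivity)]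
        congr 1
        rw [mul_pow, div_pow, div_pow, mul_pow, sq_sqrt hΩ]
        ring

theorem memLp_stepFun_samples : MemLp (stepFun x (samples x g)) 2 := by
  have herror : MemLp (⇑g - stepFun x (samples x g)) 2 volume :=
    ⟨(Lp.aestronglyMeasurable g).sub (aestronglyMeasurable_stepFun hx hx_top hx_bot _),
      (eLpNorm_sub_stepFun_samples_le hinf hx hx_top hx_bot hδ hL hLb hΩ hLΩ hg).trans_lt
        ENNReal.ofReal_lt_top⟩
  simpa only [sub_sub_cancel] using (Lp.memLp g).sub herror

theorem norm_sub_stepL2_samples_le :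
    ‖g - stepL2 x (samples x g)‖ ≤ δ * √Ω / π * ‖g‖ := by
  have hδ₀ : 0 ≤ δ := (weightedGap_nonneg hx p 0).trans (hδ 0)
  have hmem := memLp_stepFun_samples hinf hx hx_top hx_bot hδ hL hLb hΩ hLΩ hg
  have hstep : stepL2 x (samples x g) =ᵐ[volume] stepFun x (samples x g) :=
    (stepL2_eq_toLp hmem).symm ▸ hmem.coeFn_toLp
  rw [Lp.norm_def]
  refine ENNReal.toReal_le_of_le_ofReal (by positivity) ?_
  rw [eLpNorm_congr_ae ((Lp.coeFn_sub _ _).trans ((ae_eq_refl _).sub hstep))]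
  exact eLpNorm_sub_stepFun_samples_le hinf hx hx_top hx_bot hδ hL hLb hΩ hLΩ hg

end SamplingOnPaleyWiener

section Iteration

variable {E : Type*} [NormedAddCommGroup E] {T : E → E} {W : Set E} {γ : ℝ} {f : E}

theorem norm_iterate_le (hTW : MapsTo T W W) (hT : ∀ g ∈ W, ‖T g‖ ≤ γ * ‖g‖) (hγ₀ : 0 ≤ γ)
    (hf : f ∈ W) (n : ℕ) : ‖T^[n] f‖ ≤ γ ^ n * ‖f‖ := by
  induction n with
  | zero => simp
  | succ n ih =>
    calc ‖T^[n + 1] f‖ = ‖T (T^[n] f)‖ := by rw [Function.iterate_succ_apply']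
      _ ≤ γ * ‖T^[n] f‖ := hT _ (hTW.iterate n hf)
      _ ≤ γ * (γ ^ n * ‖f‖) := by gcongr
      _ = γ ^ (n + 1) * ‖f‖ := by ring

theorem hasSum_iterate_sub_iterate_succ (hTW : MapsTo T W W) (hT : ∀ g ∈ W, ‖T g‖ ≤ γ * ‖g‖)
    (hγ₀ : 0 ≤ γ) (hγ₁ : γ < 1) (hf : f ∈ W) :
    HasSum (fun n => T^[n] f - T^[n + 1] f) f := by
  have hnorm := norm_iterate_le hTW hT hγ₀ hf
  have hgeom : Summable fun n => γ ^ n * ‖f‖ :=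
    (summable_geometric_of_lt_one hγ₀ hγ₁).mul_right _
  have hnorm_summable : Summable fun n => ‖T^[n] f‖ :=
    hgeom.of_nonneg_of_le (fun _ => norm_nonneg _) hnorm
  have hsummable : Summable fun n => ‖T^[n] f - T^[n + 1] f‖ :=
    (hnorm_summable.add ((summable_nat_add_iff 1).2 hnorm_summable)).of_nonneg_of_le
      (fun _ => norm_nonneg _) fun _ => norm_sub_le _ _
  refine (hasSum_iff_tendsto_nat_of_summable_norm hsummable).2 ?_
  simp only [Finset.sum_range_sub', Function.iterate_zero_apply]
  simpa only [sub_zero] using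
    (tendsto_zero_iff_norm_tendsto_zero.2 hnorm_summable.tendsto_atTop_zero).const_sub f

end Iteration

section Reconstruction

variable {p : ℝ → ℝ} {L : Set ℝ} {x : ℤ → ℝ}

/-- The operator `g ↦ g - P_Λ (∑ g(x_i) χ_i)`, whose iterates drive the reconstruction algorithm. -/
noncomputable def residual (p : ℝ → ℝ) (L : Set ℝ) (x : ℤ → ℝ) (g : L2R) : L2R :=
  g - pwProj p L (stepL2 x (samples x g))

theorem mapsTo_residual (hL : MeasurableSet L) : MapsTo (residual p L x) (PW p L) (PW p L) :=
  fun _ hg => sub_mem_PW hg (pwProj_mem_PW hL _)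

theorem increment_mem_PW (hL : MeasurableSet L) (c : ℤ → ℂ) (n : ℕ) :
    increment p L x c n ∈ PW p L := by
  induction n with
  | zero => exact pwProj_mem_PW hL _
  | succ n ih => exact mapsTo_residual hL ih

theorem norm_residual_le (hL : MeasurableSet L) {g : L2R} (hg : g ∈ PW p L) :
    ‖residual p L x g‖ ≤ ‖g - stepL2 x (samples x g)‖ := by
  have hproj : residual p L x g = pwProj p L (g - stepL2 x (samples x g)) := by
    rw [map_sub, mem_PW_iff.1 hg, residual]
  exact hproj ▸ norm_pwProj_le hL _

theorem residual_sub (hx : Monotone x) (hx_top : Tendsto x atTop atTop)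
    (hx_bot : Tendsto x atBot atBot) {f g : L2R} (hf : HasContRep f) (hg : HasContRep g)
    (hfm : MemLp (stepFun x (samples x f)) 2) (hgm : MemLp (stepFun x (samples x g)) 2) :
    residual p L x (f - g) = residual p L x f - residual p L x g := by
  simp only [residual]
  rw [samples_sub hf hg, stepL2_sub hx hx_top hx_bot hfm hgm, map_sub, sub_sub_sub_comm]

section Iterates

variable (hres : ∀ f ∈ PW p L, ∀ g ∈ PW p L,
    residual p L x (f - g) = residual p L x f - residual p L x g)
  (hL : MeasurableSet L) {f : L2R} (hf : f ∈ PW p L)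

include hres hL hf

theorem increment_eq_iterate_residual (n : ℕ) : increment p L x (samples x f) n =
    (residual p L x)^[n] f - (residual p L x)^[n + 1] f := by
  induction n with
  | zero => simp [increment, residual]
  | succ n ih =>
    change residual p L x (increment p L x (samples x f) n) = _
    rw [ih, hres _ ((mapsTo_residual hL).iterate n hf) _ ((mapsTo_residual hL).iterate (n + 1) hf),
      ← Function.iterate_succ_apply' (residual p L x) n,
      ← Function.iterate_succ_apply' (residual p L x) (n + 1)]

theorem approx_eq_sub_iterate_residual (n : ℕ) :
    approx p L x (samples x f) n = f - (residual p L x)^[n + 1] f := by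
  induction n with
  | zero => simp [approx, increment, residual]
  | succ n ih =>
    rw [approx, ih, increment_eq_iterate_residual hres hL hf]
    abel

variable {γ : ℝ} (hγ₀ : 0 ≤ γ) (hγ : ∀ g ∈ PW p L, ‖residual p L x g‖ ≤ γ * ‖g‖)

include hγ₀ hγ

theorem norm_sub_approx_le (n : ℕ) :
    ‖f - approx p L x (samples x f) n‖ ≤ γ ^ (n + 1) * ‖f‖ := by
  rw [approx_eq_sub_iterate_residual hres hL hf, sub_sub_cancel]
  exact norm_iterate_le (mapsTo_residual hL) hγ hγ₀ hf _

theorem hasSum_increment (hγ₁ : γ < 1) : HasSum (increment p L x (samples x f)) f := by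
  rw [funext (increment_eq_iterate_residual hres hL hf)]
  exact hasSum_iterate_sub_iterate_succ (mapsTo_residual hL) hγ hγ₀ hγ₁ hf

end Iterates

theorem approx_eq_sum_increment (c : ℤ → ℂ) (n : ℕ) :
    approx p L x c n = ∑ k ∈ Finset.range (n + 1), increment p L x c k := by
  induction n with
  | zero => rw [zero_add, Finset.sum_range_one, approx]
  | succ n ih => rw [Finset.sum_range_succ, ← ih, approx]

theorem tendsto_approx {c : ℤ → ℂ} {f : L2R} (h : HasSum (increment p L x c) f) :
    Tendsto (approx p L x c) atTop (𝓝 f) := by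
  rw [funext (approx_eq_sum_increment c)]
  exact h.tendsto_sum_nat.comp (tendsto_add_atTop_nat 1)

end Reconstruction

theorem div_pow_mul_le_div_pow_mul_ratio_mul {a b : ℝ} (ha : 0 ≤ a) (hab : a < b) (n : ℕ)
    {r : ℝ} (hr : 0 ≤ r) :
    (a / b) ^ n * r ≤ (a / b) ^ n * ((b + a) / (b - a)) * r := by
  have hratio : 1 ≤ (b + a) / (b - a) := (one_le_div (sub_pos.2 hab)).2 (by linarith)
  have hb : 0 < b := ha.trans_lt hab
  exact mul_le_mul_of_nonneg_right (le_mul_of_one_le_right (by positivity) hratio) hr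

end VarBandwidth

open VarBandwidth Set Real in
theorem mainTheorem4_general (p : ℝ → ℝ) (hp_meas : AEMeasurable p (volume : Measure ℝ))
    (Ω : ℝ) (hΩ : 0 < Ω) (L : Set ℝ) (hL_meas : MeasurableSet L) (hL : L ⊆ Icc 0 Ω)
    (x : ℤ → ℝ) (hx_mono : Monotone x)
    (hx_top : Tendsto x atTop atTop) (hx_bot : Tendsto x atBot atBot)
    (hp_inf : ∀ i, 0 < ⨅ t : Icc (x i) (x (i + 1)), √(p t))
    (δ : ℝ) (hδ : IsLUB (range (weightedGap p x)) δ) (hgap : δ < π / √Ω) :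
    (∀ g ∈ PW p L, HasContRep g ∧ MemLp (stepFun x (samples x g)) 2) ∧
    ∀ f ∈ PW p L,
      (∀ n, increment p L x (samples x f) n ∈ PW p L) ∧
      Tendsto (approx p L x (samples x f)) atTop (𝓝 f) ∧
      HasSum (increment p L x (samples x f)) f ∧
      ∀ n : ℕ, ‖f - approx p L x (samples x f) n‖ ≤
        (δ * √Ω / π) ^ (n + 1) * ((π + δ * √Ω) / (π - δ * √Ω)) * ‖f‖ := by
  have hδ' (i : ℤ) : weightedGap p x i ≤ δ := hδ.1 (mem_range_self i)
  have hγ₀ : 0 ≤ δ * √Ω :=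
    mul_nonneg ((weightedGap_nonneg hx_mono p 0).trans (hδ' 0)) (sqrt_nonneg Ω)
  have hγ₁ : δ * √Ω < π := (lt_div_iff₀ (sqrt_pos.2 hΩ)).1 hgap
  have hLb : Bornology.IsBounded L := (Metric.isBounded_Icc 0 Ω).subset hL
  have hLΩ : L ⊆ Iic Ω := hL.trans Icc_subset_Iic_self
  have hrep : ∀ g ∈ PW p L, HasContRep g := fun g =>
    hasContRep_of_mem_PW (fun t => (pos_of_iInf_sqrt_pos hp_inf hx_top hx_bot t).le) hL_meas hLb
  have hmem : ∀ g ∈ PW p L, MemLp (stepFun x (samples x g)) 2 := fun g =>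
    memLp_stepFun_samples hp_inf hx_mono hx_top hx_bot hδ' hL_meas hLb hΩ.le hLΩ
  have hcontr : ∀ g ∈ PW p L, ‖residual p L x g‖ ≤ δ * √Ω / π * ‖g‖ := fun g hg =>
    (norm_residual_le hL_meas hg).trans (norm_sub_stepL2_samples_le hp_inf hx_mono hx_top hx_bot
      hδ' hL_meas hLb hΩ.le hLΩ hg)
  have hres : ∀ f ∈ PW p L, ∀ g ∈ PW p L,
      residual p L x (f - g) = residual p L x f - residual p L x g := fun f hf g hg =>
    residual_sub hx_mono hx_top hx_bot (hrep f hf) (hrep g hg) (hmem f hf) (hmem g hg)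
  refine ⟨fun g hg => ⟨hrep g hg, hmem g hg⟩, fun f hf => ?_⟩
  have hsum := hasSum_increment hres hL_meas hf (div_nonneg hγ₀ pi_nonneg) hcontr
    ((div_lt_one pi_pos).2 hγ₁)
  exact ⟨increment_mem_PW hL_meas _, tendsto_approx hsum, hsum, fun n =>
    (norm_sub_approx_le hres hL_meas hf (div_nonneg hγ₀ pi_nonneg) hcontr n).trans
      (div_pow_mul_le_div_pow_mul_ratio_mul hγ₀ hγ₁ (n + 1) (norm_nonneg f))⟩

theorem mainTheorem4 (p : ℝ → ℝ) (hp_meas : AEMeasurable p (volume : Measure ℝ))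
    (hp_inf : ∃ c : ℝ, 0 < c ∧ ∀ t, c ≤ p t)
    (Ω : ℝ) (hΩ : 0 < Ω) (L : Set ℝ) (hL_meas : MeasurableSet L) (hL : L ⊆ Set.Icc 0 Ω)
    (x : ℤ → ℝ) (hx_mono : Monotone x)
    (hx_top : Tendsto x atTop atTop) (hx_bot : Tendsto x atBot atBot)
    (δ : ℝ) (hδ : IsLUB (Set.range (VarBandwidth.weightedGap p x)) δ)
    (hgap : δ < Real.pi / √Ω) :
    -- point evaluation and the step functions make sense on the Paley-Wiener space
    (∀ g ∈ VarBandwidth.PW p L, VarBandwidth.HasContRep g ∧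
      MemLp (VarBandwidth.stepFun x (VarBandwidth.samples x g)) 2 (volume : Measure ℝ)) ∧
    ∀ f ∈ VarBandwidth.PW p L,
      (∀ n, VarBandwidth.increment p L x (VarBandwidth.samples x f) n ∈ VarBandwidth.PW p L) ∧
      Tendsto (VarBandwidth.approx p L x (VarBandwidth.samples x f)) atTop (𝓝 f) ∧
      HasSum (VarBandwidth.increment p L x (VarBandwidth.samples x f)) f ∧
      ∀ n : ℕ, ‖f - VarBandwidth.approx p L x (VarBandwidth.samples x f) n‖ ≤
        (δ * √Ω / Real.pi) ^ (n + 1) * ((Real.pi + δ * √Ω) / (Real.pi - δ * √Ω)) * ‖f‖ := by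
  obtain ⟨c, hc, hp⟩ := hp_inf
  exact mainTheorem4_general p hp_meas Ω hΩ L hL_meas hL x hx_mono hx_top hx_bot (fun i =>
    VarBandwidth.iInf_sqrt_pos (Set.nonempty_Icc.2 (hx_mono (lt_add_one i).le)) hc fun t _ => hp t)
    δ hδ hgap
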